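/- Let $\Phi$ be an irreducible, reduced, crystallographic root system in a finite-dimensional $\mathbb{Q}$-vector space $E$, with Weyl group $W$ and coroots $\alpha^\vee$ ($\alpha\in\Phi$), and write $(v,\alpha^\vee)\in\mathbb{Q}$ for the pairing of $v\in E$ with $\alpha^\vee$ (so that $(v,\alpha^\vee)=2(v,\alpha)/(\alpha,\alpha)$ for any $W$-invariant scalar product on $E$). Let $\{\alpha_i\mid i\in I\}$ be a set of simple roots and $\Lambda=\{v\in E\mid (v,\alpha_i^\vee)\in\mathbb{Z}\text{ for all }i\in I\}$ the weight lattice. A non-zero weight $\lambda\in\Lambda$ is called minuscule if it is dominant, i.e. $(\lambda,\alpha_i^\vee)\ge 0$ for all $i\in I$, and $(\lambda,\alpha^\vee)\in\{0,\pm1\}$ for all $\alpha\in\Phi$. Let $\Psi\subseteq\Lambda$ be a non-empty union of $W$-orbits of minuscule weights, let $M$ be a $\mathbb{C}$-vector space with basis $\{z_\mu\mid\mu\in\Psi\}$, and define linear maps $e_i,f_i,h_i\colon M\to M$ ($i\in I$) by \[ e_i(z_\mu)=\begin{cases} z_{\mu+\alpha_i} & \text{if }(\mu,\alpha_i^\vee)=-1,\\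 0&\text{otherwise,}\end{cases}\qquad f_i(z_\mu)=\begin{cases} z_{\mu-\alpha_i} & \text{if }(\mu,\alpha_i^\vee)=1,\\ 0&\text{otherwise,}\end{cases}\qquad h_i(z_\mu)=(\mu,\alpha_i^\vee)z_\mu .\] Let $\mathfrak{g}\subseteq\mathfrak{gl}(M)$ be the Lie subalgebra generated by all $e_i,f_i$ ($i\in I$), and let $\mathfrak{h}=\langle h_i\mid i\in I\rangle_{\mathbb{C}}$, which is an abelian subalgebra of $\mathfrak{g}$ with basis $\{h_i\mid i\in I\}$. For $\mu\in E$ let $\dot\mu\in\mathfrak{h}^*$ be the linear form with $\dot\mu(h_j)=(\mu,\alpha_j^\vee)$ for all $j\in I$. For $\chi\in\mathfrak{h}^*$ let $\mathfrak{g}_\chi=\{x\in\mathfrak{g}\mid[h,x]=\chi(h)x\text{ for all }h\in\mathfrak{h}\}$, and write $\mathfrak{g}_\alpha=\mathfrak{g}_{\dot\alpha}$ for $\alpha\in\Phi$. Then $\mathfrak{g}$ is a simple Lie algebra, $\mathfrak{h}$ is a Cartan subalgebra of $\mathfrak{g}$, and the root system of $\mathfrak{g}$ with respect to $\mathfrak{h}$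 is $\dot\Phi=\{\dot\alpha\mid\alpha\in\Phi\}$, that is, $\{\chi\in\mathfrak{h}^*\mid \chi\ne0,\ \mathfrak{g}_\chi\neq0\}=\dot\Phi$. In particular, there is a direct sum decomposition $\mathfrak{g}=\mathfrak{h}\oplus\bigoplus_{\alpha\in\Phi}\mathfrak{g}_\alpha$, where $\dim\mathfrak{g}_\alpha=1$ for all $\alpha\in\Phi$. -/

import Mathlib

noncomputable section

open Module Set

-- The Lie ring structure of `gl(M)` is the commutator bracket `⁅x, y⁆ = x * y - y * x`.
attribute [local instance 100] LieRing.ofAssociativeRing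

namespace Minuscule

variable {ι E E' : Type*} [AddCommGroup E] [Module ℚ E] [AddCommGroup E'] [Module ℚ E']
variable {P : RootPairing ι ℚ E E'}

/-- The weight lattice `Λ`: the vectors of `E` whose pairings with all simple coroots are integers
(equivalently, the `ℤ`-span of the basis of `E` dual to the simple coroots). -/
def weightLattice (b : P.Base) : AddSubgroup E where
  carrier := {v | ∀ i ∈ b.support, ∃ n : ℤ, P.toLinearMap v (P.coroot i) = n}
  zero_mem' i _ := ⟨0, by simp⟩
  add_mem' {v w} hv hw i hi := by
    obtain ⟨m, hm⟩ := hv i hi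
    obtain ⟨n, hn⟩ := hw i hi
    exact ⟨m + n, by simp [hm, hn]⟩
  neg_mem' {v} hv i hi := by
    obtain ⟨m, hm⟩ := hv i hi
    exact ⟨-m, by simp [hm]⟩

/-- A minuscule (dominant) weight: a non-zero dominant weight whose pairing with every coroot is
`0`, `1` or `-1`. -/
structure IsMinuscule (b : P.Base) (v : E) : Prop where
  mem_weightLattice : v ∈ weightLattice b
  ne_zero : v ≠ 0
  dominant : ∀ i ∈ b.support, 0 ≤ P.toLinearMap v (P.coroot i)
  pairing : ∀ i : ι, P.toLinearMap v (P.coroot i) ∈ ({0, 1, -1} : Set ℚ)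

/-- `Ψ` is a non-empty union of Weyl group orbits of minuscule weights. -/
def IsMinusculeUnion (b : P.Base) (Ψ : Set E) : Prop :=
  ∃ S : Set E, S.Nonempty ∧ (∀ v ∈ S, IsMinuscule b v) ∧
    Ψ = ⋃ v ∈ S, MulAction.orbit P.weylGroup v

/-! ### Elementary facts which make the operators below well-defined -/

section facts

variable {b : P.Base} {Ψ : Set E}

lemma pairing_smul (w : P.weylGroup) (v : E)
    (hv : ∀ i : ι, P.toLinearMap v (P.coroot i) ∈ ({0, 1, -1} : Set ℚ)) (i : ι) :
    P.toLinearMap (w • v) (P.coroot i) ∈ ({0, 1, -1} : Set ℚ) := by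
  obtain ⟨g, hg⟩ := w
  induction hg using RootPairing.weylGroup.induction generalizing v i with
  | mem j =>
    have h : P.toLinearMap (P.reflection j v) (P.coroot i) =
        P.toLinearMap v (P.coroot (P.reflectionPerm j i)) := by
      rw [← P.reflectionPerm_coroot, RootPairing.reflection_apply]
      simp only [map_sub, map_smul, LinearMap.sub_apply, LinearMap.smul_apply, smul_eq_mul]
      simp [RootPairing.coroot', mul_comm]
    have h' : (⟨_, P.reflection_mem_weylGroup j⟩ : P.weylGroup) • v = P.reflection j v := by
      exact RootPairing.weylGroup.ofIdx_smul P j v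
    rw [h', h]
    exact hv _
  | one => simpa using! hv i
  | mul g₁ g₂ hg₁ hg₂ h₁ h₂ =>
    rw [← Submonoid.mk_mul_mk _ _ _ hg₁ hg₂, mul_smul]
    exact h₁ _ (fun j ↦ h₂ _ hv j) i

lemma IsMinusculeUnion.pairing_mem (hΨ : IsMinusculeUnion b Ψ) {v : E} (hv : v ∈ Ψ) (i : ι) :
    P.toLinearMap v (P.coroot i) ∈ ({0, 1, -1} : Set ℚ) := by
  obtain ⟨S, -, hS, rfl⟩ := hΨ
  obtain ⟨u, hu, w, rfl⟩ := mem_iUnion₂.1 hv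
  exact pairing_smul w u (hS u hu).pairing i

lemma IsMinusculeUnion.reflection_mem (hΨ : IsMinusculeUnion b Ψ) {v : E} (hv : v ∈ Ψ) (i : ι) :
    P.reflection i v ∈ Ψ := by
  obtain ⟨S, -, -, rfl⟩ := hΨ
  obtain ⟨u, hu, w, rfl⟩ := mem_iUnion₂.1 hv
  refine mem_iUnion₂.2 ⟨u, hu, RootPairing.weylGroup.ofIdx P i * w, ?_⟩
  exact mul_smul _ _ _

lemma IsMinusculeUnion.add_root_mem (hΨ : IsMinusculeUnion b Ψ) {v : E} (hv : v ∈ Ψ) {i : ι}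
    (h : P.toLinearMap v (P.coroot i) = -1) : v + P.root i ∈ Ψ := by
  have := hΨ.reflection_mem hv i
  rwa [RootPairing.reflection_apply, RootPairing.coroot', LinearMap.flip_apply, h, neg_one_smul,
    sub_neg_eq_add] at this

lemma IsMinusculeUnion.sub_root_mem (hΨ : IsMinusculeUnion b Ψ) {v : E} (hv : v ∈ Ψ) {i : ι}
    (h : P.toLinearMap v (P.coroot i) = 1) : v - P.root i ∈ Ψ := by
  have := hΨ.reflection_mem hv i
  rwa [RootPairing.reflection_apply, RootPairing.coroot', LinearMap.flip_apply, h, one_smul] at this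

lemma IsMinusculeUnion.span_eq_top [P.IsIrreducible] (hΨ : IsMinusculeUnion b Ψ) :
    Submodule.span ℚ Ψ = ⊤ := by
  refine RootPairing.IsIrreducible.eq_top_of_invtSubmodule_reflection (P := P) _ (fun i ↦ ?_) ?_
  · rw [Module.End.mem_invtSubmodule, Submodule.span_le]
    intro v hv
    exact Submodule.subset_span (hΨ.reflection_mem hv i)
  · obtain ⟨S, ⟨v, hv⟩, hS, rfl⟩ := hΨ
    rw [Submodule.ne_bot_iff]
    exact ⟨v, Submodule.subset_span (mem_iUnion₂.2 ⟨v, hv, MulAction.mem_orbit_self v⟩),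
      (hS v hv).ne_zero⟩

end facts

/-! ### Jantzen's operators on the space with basis `z_μ`, `μ ∈ Ψ` -/

variable {b : P.Base} {Ψ : Set E} {M : Type*} [AddCommGroup M] [Module ℂ M]

/-- `e_i z_μ = z_{μ + α_i}` if `(μ, α_i^∨) = -1`, and `e_i z_μ = 0` otherwise. -/
def opE (hΨ : IsMinusculeUnion b Ψ) (z : Basis Ψ ℂ M) (i : b.support) : End ℂ M :=
  z.constr ℂ fun μ ↦
    if h : P.toLinearMap μ (P.coroot i) = -1 then z ⟨μ + P.root i, hΨ.add_root_mem μ.2 h⟩ else 0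

/-- `f_i z_μ = z_{μ - α_i}` if `(μ, α_i^∨) = 1`, and `f_i z_μ = 0` otherwise. -/
def opF (hΨ : IsMinusculeUnion b Ψ) (z : Basis Ψ ℂ M) (i : b.support) : End ℂ M :=
  z.constr ℂ fun μ ↦
    if h : P.toLinearMap μ (P.coroot i) = 1 then z ⟨μ - P.root i, hΨ.sub_root_mem μ.2 h⟩ else 0

/-- `h_i z_μ = (μ, α_i^∨) z_μ`. -/
def opH (z : Basis Ψ ℂ M) (i : b.support) : End ℂ M :=
  z.constr ℂ fun μ ↦ (P.toLinearMap μ (P.coroot i) : ℂ) • z μ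

/-- The Lie subalgebra `𝔤` of `gl(M)` generated by all `e_i` and `f_i`. -/
def lieAlg (hΨ : IsMinusculeUnion b Ψ) (z : Basis Ψ ℂ M) : LieSubalgebra ℂ (End ℂ M) :=
  LieSubalgebra.lieSpan ℂ (End ℂ M) (range (opE hΨ z) ∪ range (opF hΨ z))

lemma lie_opE_opF (hΨ : IsMinusculeUnion b Ψ) (z : Basis Ψ ℂ M) (i : b.support) :
    ⁅opE hΨ z i, opF hΨ z i⁆ = opH z i := by
  refine z.ext fun μ ↦ ?_
  have h2 := P.root_coroot_two i
  rcases hΨ.pairing_mem μ.2 i with h | h | h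
  · simp [Ring.lie_def, opE, opF, opH, h]
  · simp [Ring.lie_def, opE, opF, opH, h, h2]
    norm_num
  · rw [mem_singleton_iff] at h
    simp [Ring.lie_def, opE, opF, opH, h, h2]
    norm_num

lemma opH_mem (hΨ : IsMinusculeUnion b Ψ) (z : Basis Ψ ℂ M) (i : b.support) :
    opH z i ∈ lieAlg hΨ z := by
  rw [← lie_opE_opF hΨ z i]
  exact LieSubalgebra.lie_mem _ (LieSubalgebra.subset_lieSpan (.inl ⟨i, rfl⟩))
    (LieSubalgebra.subset_lieSpan (.inr ⟨i, rfl⟩))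

/-- `h_i` as an element of `𝔤`. -/
def elH (hΨ : IsMinusculeUnion b Ψ) (z : Basis Ψ ℂ M) (i : b.support) : lieAlg hΨ z :=
  ⟨opH z i, opH_mem hΨ z i⟩

lemma lie_elH_elH (hΨ : IsMinusculeUnion b Ψ) (z : Basis Ψ ℂ M) (i j : b.support) :
    ⁅elH hΨ z i, elH hΨ z j⁆ = 0 := by
  refine Subtype.ext (z.ext fun μ ↦ ?_)
  simp [elH, Ring.lie_def, opH, smul_smul, mul_comm]

/-- `𝔥`, the linear span of the `h_i`, as a Lie subalgebra of `𝔤`. -/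
def cartan (hΨ : IsMinusculeUnion b Ψ) (z : Basis Ψ ℂ M) : LieSubalgebra ℂ (lieAlg hΨ z) where
  __ := Submodule.span ℂ (range (elH hΨ z))
  lie_mem' {x y} hx hy := by
    have : ⁅x, y⁆ = 0 := by
      induction hx, hy using Submodule.span_induction₂ with
      | mem_mem x y hx hy =>
        obtain ⟨i, rfl⟩ := hx
        obtain ⟨j, rfl⟩ := hy
        exact lie_elH_elH hΨ z i j
      | zero_left => simp
      | zero_right => simp
      | add_left x y w _ _ _ h₁ h₂ => simp [h₁, h₂]
      | add_right x y w _ _ _ h₁ h₂ => simp [h₁, h₂]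
      | smul_left r x y _ _ h => simp [h]
      | smul_right r x y _ _ h => simp [h]
    rw [this]
    exact Submodule.zero_mem _

lemma linearIndependent_elH [P.IsRootSystem] [P.IsIrreducible] (hΨ : IsMinusculeUnion b Ψ)
    (z : Basis Ψ ℂ M) : LinearIndependent ℂ (elH hΨ z) := by
  classical
  rw [Fintype.linearIndependent_iff]
  intro x hx
  -- the functional `v ↦ ∑ x_j (v, α_j^∨)` on `E` vanishes on `Ψ`, hence on `E`
  let φ : E →ₗ[ℚ] ℂ :=
    ∑ j : b.support, ((LinearMap.toSpanSingleton ℚ ℂ (x j)) ∘ₗ P.toLinearMap.flip (P.coroot j))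
  have hφ (v : E) : φ v = ∑ j : b.support, (P.toLinearMap v (P.coroot j) : ℂ) * x j := by
    simp [φ, Rat.smul_def]
  have h0 : φ = 0 := by
    refine LinearMap.ext_on hΨ.span_eq_top fun v hv ↦ ?_
    have h1 : (∑ j, x j • opH z j : End ℂ M) (z ⟨v, hv⟩) = 0 := by
      have h2 := congrArg (lieAlg hΨ z).toSubmodule.subtype hx
      rw [map_sum, map_zero] at h2
      exact LinearMap.congr_fun h2 _
    simp only [opH, LinearMap.sum_apply, LinearMap.smul_apply, Basis.constr_basis, smul_smul,
      ← Finset.sum_smul, smul_eq_zero, z.ne_zero, or_false] at h1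
    rw [hφ, LinearMap.zero_apply, ← h1]
    exact Finset.sum_congr rfl fun j _ ↦ mul_comm _ _
  intro i
  let d : Dual ℚ E' := b.toCoweightBasis.coord i
  have h2 := hφ (P.toPerfPair.symm d)
  have h3 (j : b.support) : P.toLinearMap (P.toPerfPair.symm d) (P.coroot j) =
      if j = i then 1 else 0 := by
    have : P.toLinearMap (P.toPerfPair.symm d) = d := P.toPerfPair.apply_symm_apply d
    rw [this, ← b.toCoweightBasis_apply j]
    simp [d, Finsupp.single_apply]
  rw [h0, LinearMap.zero_apply, Finset.sum_eq_single i
      (fun j _ hj ↦ by rw [h3, if_neg hj, Rat.cast_zero, zero_mul]) (by simp),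
    h3, if_pos rfl, Rat.cast_one, one_mul] at h2
  exact h2.symm

/-- The `h_i` form a basis of `𝔥`. -/
def basisH [P.IsRootSystem] [P.IsIrreducible] (hΨ : IsMinusculeUnion b Ψ) (z : Basis Ψ ℂ M) :
    Basis b.support ℂ (cartan hΨ z) :=
  Basis.span (linearIndependent_elH hΨ z)

lemma coe_basisH [P.IsRootSystem] [P.IsIrreducible] (hΨ : IsMinusculeUnion b Ψ) (z : Basis Ψ ℂ M)
    (i : b.support) : (basisH hΨ z i : lieAlg hΨ z) = elH hΨ z i :=
  congrArg Subtype.val (Basis.span_apply (linearIndependent_elH hΨ z) i)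

/-- For `μ ∈ E`, the linear form `μ̇` on `𝔥` with `μ̇(h_j) = (μ, α_j^∨)` for all `j`. -/
def dot [P.IsRootSystem] [P.IsIrreducible] (hΨ : IsMinusculeUnion b Ψ) (z : Basis Ψ ℂ M) (μ : E) :
    Dual ℂ (cartan hΨ z) :=
  (basisH hΨ z).constr ℂ fun j ↦ (P.toLinearMap μ (P.coroot j) : ℂ)

/-- `𝔤_χ = {x ∈ 𝔤 | ⁅h, x⁆ = χ(h) x for all h ∈ 𝔥}`. -/
def rootSpace (hΨ : IsMinusculeUnion b Ψ) (z : Basis Ψ ℂ M) (χ : Dual ℂ (cartan hΨ z)) :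
    Submodule ℂ (lieAlg hΨ z) :=
  (LieModule.weightSpace (lieAlg hΨ z) χ).toSubmodule

lemma mem_rootSpace (hΨ : IsMinusculeUnion b Ψ) (z : Basis Ψ ℂ M) (χ : Dual ℂ (cartan hΨ z))
    (x : lieAlg hΨ z) :
    x ∈ rootSpace hΨ z χ ↔ ∀ h : cartan hΨ z, ⁅(h : lieAlg hΨ z), x⁆ = χ h • x :=
  LieModule.mem_weightSpace _ x

/-- The family of subspaces `𝔥` (at `none`) and `𝔤_α`, `α ∈ Φ` (at `some`). -/
def rootDecomposition [P.IsRootSystem] [P.IsIrreducible] (hΨ : IsMinusculeUnion b Ψ)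
    (z : Basis Ψ ℂ M) : Option ι → Submodule ℂ (lieAlg hΨ z)
  | none => (cartan hΨ z).toSubmodule
  | some i => rootSpace hΨ z (dot hΨ z (P.root i))

end Minuscule

end

/-!
The `e_i`, `f_i`, `h_i` satisfy the Chevalley–Serre relations given by the Cartan matrix of `Φ`.
For the scalar product on `M` in which the `z_μ` are orthonormal, `f_i` is the adjoint of `e_i`, so
`𝔤` is stable under `x ↦ x*`, and `tr (x x*) > 0` for `x ≠ 0`. If `x ≠ 0` is a weight vector in an
ideal, of non-zero weight, this makes `[x, x*]` a non-zero element of the ideal centralising `𝔥`,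
hence lying in `𝔥`. So every non-zero ideal meets `𝔥`, thus contains some `e_i`, and by
connectedness of the Dynkin diagram all of `𝔤`, which is therefore simple. Finally `Φ` and the roots
of `𝔤` are both obtained from their simple roots by simple reflections, and `μ ↦ μ̇` matches these.
-/

noncomputable section

open Module Set

attribute [local instance 100] LieRing.ofAssociativeRing

namespace Minuscule

section RootPairing

variable {ι κ R S M N M' N' : Type*} [CommRing R] [AddCommGroup M] [Module R M] [AddCommGroup N]
  [Module R N] [CommRing S] [AddCommGroup M'] [Module S M'] [AddCommGroup N'] [Module S N']
  {P : RootPairing ι R M N} {Q : RootPairing κ S M' N'} [P.IsCrystallographic]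

lemma intCast_cartanMatrix (b : P.Base) (i j : b.support) :
    (b.cartanMatrix i j : R) = P.pairing i j :=
  b.algebraMap_cartanMatrixIn_apply ℤ i j

variable [Finite ι] [CharZero R] [IsDomain R] [P.IsReduced]

lemma range_root_subset_of_reflection_mem (b : P.Base) {T : Set M} (hneg : ∀ v ∈ T, -v ∈ T)
    (hroot : ∀ i ∈ b.support, P.root i ∈ T)
    (hrefl : ∀ i ∈ b.support, ∀ v ∈ T, P.reflection i v ∈ T) : range P.root ⊆ T := by
  rintro - ⟨i, rfl⟩
  refine b.induction_reflect i (p := fun i ↦ P.root i ∈ T) (fun i hi ↦ ?_) hroot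
    fun i j hi hj ↦ ?_
  · rw [P.root_reflectionPerm, P.reflection_apply_self]
    exact hneg _ hi
  · rw [P.root_reflectionPerm]
    exact hrefl j hj _ hi

lemma range_comp_root_eq_range_root [Finite κ] [CharZero S] [IsDomain S] [Q.IsCrystallographic]
    [Q.IsReduced] (b : P.Base) (c : Q.Base) (e : b.support ≃ c.support) (φ : M →+ M')
    (hroot : ∀ i : b.support, φ (P.root i) = Q.root (e i))
    (hrefl : ∀ i : b.support, ∀ v, φ (P.reflection i v) = Q.reflection (e i) (φ v)) :
    range (φ ∘ P.root) = range Q.root := by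
  refine Subset.antisymm ?_ ?_
  · rw [range_comp, image_subset_iff]
    refine range_root_subset_of_reflection_mem b ?_ (fun i hi ↦ ⟨_, (hroot ⟨i, hi⟩).symm⟩) ?_
    · rintro v ⟨k, hk⟩
      exact ⟨Q.reflectionPerm k k, by
        rw [Q.root_reflectionPerm, Q.reflection_apply_self, map_neg, hk]⟩
    · rintro i hi v ⟨k, hk⟩
      exact ⟨Q.reflectionPerm (e ⟨i, hi⟩) k, by rw [Q.root_reflectionPerm, hk, ← hrefl]⟩
  · refine range_root_subset_of_reflection_mem c ?_ ?_ ?_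
    · rintro - ⟨i, rfl⟩
      exact ⟨P.reflectionPerm i i, by simp [P.reflection_apply_self]⟩
    · intro k hk
      exact ⟨e.symm ⟨k, hk⟩, by simp [hroot]⟩
    · rintro k hk - ⟨i, rfl⟩
      exact ⟨P.reflectionPerm (e.symm ⟨k, hk⟩) i, by simp [hrefl]⟩

end RootPairing

section LieBasis

variable {ι K L : Type*} [Finite ι] [Field K] [LieRing L] [LieAlgebra K L]
  {H : LieSubalgebra K L} (B : LieAlgebra.Basis ι H) {I : LieIdeal K L}

/-- The Chevalley generators `h i` as a linear basis of the Cartan subalgebra they span. -/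
def cartanBasis : Basis ι K H :=
  (Basis.span B.linInd).map (LinearEquiv.ofEq _ _ B.coe_cartan_eq_span).symm

@[simp] lemma cartanBasis_apply (i : ι) : cartanBasis B i = B.h' i :=
  Subtype.ext (congrArg Subtype.val (Basis.span_apply B.linInd i) :)

lemma smul_mem_lieIdeal_iff {c : K} (hc : c ≠ 0) {x : L} : c • x ∈ I ↔ x ∈ I :=
  I.toSubmodule.smul_mem_iff hc

lemma lieBasis_h_mem_of_e_mem {i : ι} (hi : B.e i ∈ I) : B.h i ∈ I := by
  rw [← (B.sl2 i).lie_e_f]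
  exact lie_mem_left K L I _ _ hi

variable [CharZero K]

lemma lieBasis_e_mem_of_h_mem {i j : ι} (hA : B.A j i ≠ 0) (hi : B.h i ∈ I) : B.e j ∈ I := by
  have hmem : B.A j i • B.e j ∈ I := by
    rw [← B.lie_h_e]
    exact lie_mem_left K L I _ _ hi
  rwa [← Int.cast_smul_eq_zsmul K, smul_mem_lieIdeal_iff (Int.cast_ne_zero.2 hA)] at hmem

lemma lieIdeal_eq_top_of_forall_h_mem (h : ∀ i, B.h i ∈ I) : I = ⊤ := by
  have := IsAddTorsionFree.of_isTorsionFree K L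
  have hA (i : ι) : B.A i i ≠ 0 := by simp
  have hle : LieSubalgebra.lieSpan K L (range B.e ∪ range B.f) ≤
      LieIdeal.toLieSubalgebra K L I := by
    rw [LieSubalgebra.lieSpan_le]
    rintro - (⟨i, rfl⟩ | ⟨i, rfl⟩)
    · exact lieBasis_e_mem_of_h_mem B (hA i) (h i)
    · exact lieBasis_e_mem_of_h_mem B.symm (hA i) (neg_mem (h i))
  rw [B.span_ef] at hle
  exact top_le_iff.1 fun x _ ↦ hle (LieSubalgebra.mem_top x)

lemma span_range_baseSupp [Fintype ι] : Submodule.span K (range B.baseSupp) = ⊤ := by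
  have : FiniteDimensional K H := (cartanBasis B).finiteDimensional_of_finite
  refine B.linearIndependent_baseSupp.span_eq_top_of_card_eq_finrank' ?_
  rw [Subspace.dual_finrank_eq, finrank_eq_card_basis (cartanBasis B)]

lemma exists_lieBasis_e_mem {x : L} (hxI : x ∈ I) (hxH : x ∈ H) (hx : x ≠ 0) :
    ∃ i, B.e i ∈ I := by
  have := Fintype.ofFinite ι
  obtain ⟨i, hi⟩ : ∃ i, B.baseSupp i ⟨x, hxH⟩ ≠ 0 := by
    by_contra! h
    have h0 : Dual.eval K H ⟨x, hxH⟩ = 0 := LinearMap.ext_on_range (span_range_baseSupp B) h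
    exact hx (congrArg Subtype.val ((Module.eval_apply_eq_zero_iff K _).1 h0))
  refine ⟨i, (smul_mem_lieIdeal_iff hi).1 ?_⟩
  rw [B.baseSupp_apply_smul_e]
  exact lie_mem_left K L I _ _ hxI

lemma mem_cartan_of_forall_lie_h_eq_zero {x : L} (hx : ∀ i, ⁅B.h i, x⁆ = 0) : x ∈ H := by
  have := Fintype.ofFinite ι
  have := B.isLieAbelian_cartan
  have hzero : (LieModule.toEnd K H L).toLinearMap.flip x = 0 :=
    (cartanBasis B).ext fun i ↦ by simpa [LieAlgebra.Basis.h'] using hx i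
  have hroot : x ∈ LieAlgebra.rootSpace H 0 :=
    LieModule.weightSpace_le_genWeightSpace L (0 : H → K) <|
      (LieModule.mem_weightSpace _ _).2 fun y ↦ by
        simpa using LinearMap.congr_fun hzero y
  rwa [← B.cartan_eq] at hroot

end LieBasis

section Simple

variable {ι K L : Type*} [Finite ι] [Field K] [LieRing L] [LieAlgebra K L]
  {H : LieSubalgebra K L} (B : LieAlgebra.Basis ι H) {I : LieIdeal K L}
  {τ : K →+* K} {T : LinearMap.BilinForm K L} {σ : L →ₛₗ[τ] L}

/-- `σ` plays the role of `x ↦ x*` for a compact form: it reverses brackets, fixes the `h i`, and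
is anisotropic for an invariant form `T`. Over `ℂ`, `τ` is complex conjugation and `T x (σ x) > 0`,
but only `T x (σ x) ≠ 0` matters. -/
structure IsAnisotropicAdjoint (T : LinearMap.BilinForm K L) (σ : L →ₛₗ[τ] L) : Prop where
  lieInvariant : T.lieInvariant L
  map_lie (x y : L) : σ ⁅x, y⁆ = ⁅σ y, σ x⁆
  map_h (i : ι) : σ (B.h i) = B.h i
  apply_self_ne_zero {x : L} (hx : x ≠ 0) : T x (σ x) ≠ 0

variable {B}

section weightVector

variable (hσ : IsAnisotropicAdjoint B T σ) {x : L} {c : ι → K} (hx : ∀ i, ⁅B.h i, x⁆ = c i • x)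

include hσ hx

lemma IsAnisotropicAdjoint.lie_h_lie (i : ι) :
    ⁅B.h i, ⁅x, σ x⁆⁆ = (c i - τ (c i)) • ⁅x, σ x⁆ := by
  have hσx : ⁅B.h i, σ x⁆ = -(τ (c i) • σ x) := by
    rw [← lie_skew, ← map_smulₛₗ, ← hx, hσ.map_lie, hσ.map_h]
  rw [leibniz_lie, hx, hσx, smul_lie, lie_neg, lie_smul, sub_smul, sub_eq_add_neg]

lemma IsAnisotropicAdjoint.form_h_lie (i : ι) : T (B.h i) ⁅x, σ x⁆ = c i * T x (σ x) := by
  rw [← neg_eq_iff_eq_neg.2 (hσ.lieInvariant x (B.h i) (σ x)), ← lie_skew, hx]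
  simp

lemma IsAnisotropicAdjoint.lie_h_lie_eq_zero (hx0 : x ≠ 0) (hc : c ≠ 0) (j : ι) :
    ⁅B.h j, ⁅x, σ x⁆⁆ = 0 := by
  obtain ⟨i, hi⟩ := Function.ne_iff.1 hc
  have hform : T (B.h i) ⁅x, σ x⁆ ≠ 0 := by
    rw [hσ.form_h_lie hx]
    exact mul_ne_zero hi (hσ.apply_self_ne_zero hx0)
  have hzero : (c j - τ (c j)) * T (B.h i) ⁅x, σ x⁆ = 0 := by
    rw [← smul_eq_mul, ← map_smul, ← hσ.lie_h_lie hx, ← neg_eq_zero, ← hσ.lieInvariant,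
      B.lie_h_h, map_zero, LinearMap.zero_apply]
  rw [hσ.lie_h_lie hx, (mul_eq_zero.1 hzero).resolve_right hform, zero_smul]

lemma IsAnisotropicAdjoint.exists_ne_zero_mem_cartan [CharZero K] (hx0 : x ≠ 0) (hxI : x ∈ I) :
    ∃ y ∈ I, y ∈ H ∧ y ≠ 0 := by
  by_cases hc : c = 0
  · exact ⟨x, hxI, mem_cartan_of_forall_lie_h_eq_zero B fun i ↦ by simp [hx, hc], hx0⟩
  refine ⟨⁅x, σ x⁆, lie_mem_left K L I _ _ hxI,
    mem_cartan_of_forall_lie_h_eq_zero B (hσ.lie_h_lie_eq_zero hx hx0 hc), fun h ↦ hc ?_⟩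
  ext i
  simpa [h, hσ.apply_self_ne_zero hx0] using hσ.form_h_lie hx i

end weightVector

variable [CharZero K] [FiniteDimensional K L] [IsAlgClosed K]

lemma exists_weightVector_mem (B : LieAlgebra.Basis ι H) (hI : I ≠ ⊥) :
    ∃ x ∈ I, x ≠ 0 ∧ ∃ c : ι → K, ∀ i, ⁅B.h i, x⁆ = c i • x := by
  have := B.isLieAbelian_cartan
  have : Nontrivial (I.restr H) := (LieSubmodule.nontrivial_iff_ne_bot K L (N := I)).2 hI
  obtain ⟨χ, hχ⟩ := LieModule.exists_nontrivial_weightSpace_of_isNilpotent K H (I.restr H)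
  obtain ⟨⟨x, hx⟩, hx0⟩ := exists_ne (0 : LieModule.weightSpace (I.restr H) χ)
  rw [LieModule.mem_weightSpace] at hx
  exact ⟨x, x.2, fun h ↦ hx0 (by simpa using h), fun i ↦ χ (B.h' i),
    fun i ↦ congrArg Subtype.val (hx (B.h' i))⟩

theorem IsAnisotropicAdjoint.isSimple [Nonempty ι] (hσ : IsAnisotropicAdjoint B T σ)
    (hconn : ∀ (p : ι → Prop) {i j : ι}, p i → (∀ k l, p k → B.A l k ≠ 0 → p l) → p j) :
    LieAlgebra.IsSimple K L where
  eq_bot_or_eq_top I := or_iff_not_imp_left.2 fun hI ↦ by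
    obtain ⟨x, hxI, hx0, c, hx⟩ := exists_weightVector_mem B hI
    obtain ⟨y, hyI, hyH, hy0⟩ := hσ.exists_ne_zero_mem_cartan hx hx0 hxI
    obtain ⟨i, hi⟩ := exists_lieBasis_e_mem B hyI hyH hy0
    exact lieIdeal_eq_top_of_forall_h_mem B fun j ↦
      hconn (fun j ↦ B.h j ∈ I) (lieBasis_h_mem_of_e_mem B hi) fun k l hk hlk ↦
        lieBasis_h_mem_of_e_mem B (lieBasis_e_mem_of_h_mem B hlk hk)
  non_abelian h := by
    obtain ⟨i⟩ := ‹Nonempty ι›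
    exact (B.sl2 i).h_ne_zero ((B.sl2 i).lie_e_f ▸ trivial_lie_zero _ _ _ _)

end Simple

section GenWeightSpace

variable {κ K L V : Type*} [DecidableEq κ] [Field K] [LieRing L] [LieAlgebra K L]
  [LieRing.IsNilpotent L] [AddCommGroup V] [Module K V] [LieRingModule L V] [LieModule K L V]
  [FiniteDimensional K V] [LieModule.IsTriangularizable K L V]

lemma isInternal_genWeightSpace {w : κ → L → K} (hw : Function.Injective w)
    (hrange : ∀ χ : LieModule.Weight K L V, (χ : L → K) ∈ range w) :
    DirectSum.IsInternal fun k ↦ (LieModule.genWeightSpace V (w k)).toSubmodule := by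
  rw [DirectSum.isInternal_submodule_iff_iSupIndep_and_iSup_eq_top]
  constructor
  · exact (LieSubmodule.iSupIndep_toSubmodule.2
      (LieModule.iSupIndep_genWeightSpace K L V)).comp hw
  · rw [← LieSubmodule.iSup_toSubmodule, LieSubmodule.toSubmodule_eq_top, ← top_le_iff,
      ← LieModule.iSup_genWeightSpace_eq_top' K L V, iSup_le_iff]
    intro χ
    obtain ⟨k, hk⟩ := hrange χ
    exact le_iSup_of_le k (by rw [hk])

end GenWeightSpace

section Killing

open LieAlgebra LieAlgebra.IsKilling

variable {K L : Type*} [Field K] [CharZero K] [LieRing L] [LieAlgebra K L] [FiniteDimensional K L]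
  [IsKilling K L] {H : LieSubalgebra K L} [H.IsCartanSubalgebra]
  [LieModule.IsTriangularizable K H L]

lemma weightSpace_eq_rootSpace (χ : H → K) :
    LieModule.weightSpace L χ = LieAlgebra.rootSpace H χ :=
  le_antisymm (LieModule.weightSpace_le_genWeightSpace L χ) fun _ hx ↦
    (LieModule.mem_weightSpace _ _).2 (lie_eq_smul_of_mem_rootSpace hx)

lemma setOf_weightSpace_ne_bot :
    {χ : Dual K H | χ ≠ 0 ∧ LieModule.weightSpace L χ ≠ ⊥} = range (rootSystem H).root := by
  ext χ
  simp only [mem_ofPred_eq, weightSpace_eq_rootSpace, mem_range]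
  constructor
  · rintro ⟨hχ, h⟩
    refine ⟨⟨⟨χ, h⟩, ?_⟩, LinearMap.ext fun _ ↦ rfl⟩
    simpa [LieModule.Weight.IsNonZero, LieModule.Weight.IsZero] using hχ
  · rintro ⟨α, rfl⟩
    exact ⟨(rootSystem H).ne_zero α, α.1.genWeightSpace_ne_bot⟩

lemma finrank_weightSpace_eq_one {χ : Dual K H} (hχ : χ ∈ range (rootSystem H).root) :
    finrank K (LieModule.weightSpace L χ) = 1 := by
  obtain ⟨α, rfl⟩ := hχ
  rw [weightSpace_eq_rootSpace]
  exact finrank_rootSpace_eq_one α.1 (H.isNonZero_coe_root α)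

lemma isInternal_cartan_weightSpace {κ : Type*} [DecidableEq κ] {r : κ → Dual K H}
    (hr : Function.Injective r) (hrange : range r = range (rootSystem H).root) :
    DirectSum.IsInternal fun o : Option κ ↦
      o.elim H.toSubmodule fun k ↦ (LieModule.weightSpace L (r k)).toSubmodule := by
  let w : Option κ → H → K := fun o ↦ o.elim 0 fun k ↦ r k
  have hr0 : (0 : H → K) ∉ range fun k ↦ (r k : H → K) := by
    rintro ⟨k, hk⟩
    obtain ⟨α, hα⟩ := hrange ▸ mem_range_self k
    exact (rootSystem H).ne_zero α (hα.trans (LinearMap.coe_injective hk))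
  have hw : Function.Injective w :=
    Option.injective_iff.2 ⟨LinearMap.coe_injective.comp hr, hr0⟩
  have hsummand :
      (fun o : Option κ ↦ o.elim H.toSubmodule fun k ↦
        (LieModule.weightSpace L (r k)).toSubmodule) =
      fun o ↦ (LieAlgebra.rootSpace H (w o)).toSubmodule := by
    funext o
    cases o with
    | none => exact congrArg LieSubmodule.toSubmodule (rootSpace_zero_eq K L H).symm
    | some k => exact congrArg LieSubmodule.toSubmodule (weightSpace_eq_rootSpace (r k))
  rw [hsummand]
  refine isInternal_genWeightSpace hw fun χ ↦ ?_
  by_cases hχ : χ.IsZero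
  · exact ⟨none, hχ.symm⟩
  · obtain ⟨k, hk⟩ := hrange.symm ▸ mem_range_self (f := (rootSystem H).root)
      ⟨χ, by simpa using hχ⟩
    exact ⟨some k, congrArg DFunLike.coe hk⟩

end Killing

section RootIdentification

open LieAlgebra LieAlgebra.IsKilling

variable {ι R M N K L : Type*} [Finite ι] [CommRing R] [CharZero R] [IsDomain R]
  [AddCommGroup M] [Module R M]
  [AddCommGroup N] [Module R N] {P : RootPairing ι R M N} [P.IsCrystallographic] [P.IsReduced]
  [Field K] [CharZero K] [Algebra R K] [LieRing L] [LieAlgebra K L] [FiniteDimensional K L]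
  [IsKilling K L] {H : LieSubalgebra K L} [H.IsCartanSubalgebra]
  [LieModule.IsTriangularizable K H L]

theorem range_comp_root_eq_range_rootSystem_root {b : P.Base} (B : LieAlgebra.Basis b.support H)
    (hA : B.A = b.cartanMatrix) (φ : M →ₗ[R] Dual K H)
    (hφ : ∀ v j, φ v (B.h' j) = algebraMap R K (P.toLinearMap v (P.coroot j))) :
    range (φ ∘ P.root) = range (rootSystem H).root := by
  have hroot (i : b.support) : φ (P.root i) = B.baseSupp i := by
    refine (cartanBasis B).ext fun j ↦ ?_
    rw [cartanBasis_apply, hφ, B.baseSupp_apply_h', hA, P.root_coroot_eq_pairing,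
      ← intCast_cartanMatrix, map_intCast]
  refine range_comp_root_eq_range_root b B.base B.baseSupportEquiv φ.toAddMonoidHom hroot
    fun i v ↦ ?_
  have hcoroot : (rootSystem H).coroot (B.baseSupportEquiv i) = B.h' i := B.coroot_eq_h' i
  rw [P.reflection_apply, RootPairing.reflection_apply, RootPairing.coroot', RootPairing.coroot']
  simp [hφ, hroot, hcoroot]

end RootIdentification

section ConjAdjoint

variable {κ 𝕜 M : Type*} [Fintype κ] [DecidableEq κ] [RCLike 𝕜] [AddCommGroup M] [Module 𝕜 M]
  (z : Basis κ 𝕜 M)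

/-- The adjoint `x ↦ x*` of endomorphisms for the scalar product in which `z` is orthonormal, that
is, conjugate transposition of matrices with respect to `z`. -/
def conjAdjoint : End 𝕜 M →ₗ⋆[𝕜] End 𝕜 M where
  toFun x := (LinearMap.toMatrixAlgEquiv z).symm (LinearMap.toMatrixAlgEquiv z x).conjTranspose
  map_add' x y := by simp
  map_smul' c x := by simp

lemma toMatrixAlgEquiv_conjAdjoint (x : End 𝕜 M) :
    LinearMap.toMatrixAlgEquiv z (conjAdjoint z x) =
      (LinearMap.toMatrixAlgEquiv z x).conjTranspose :=
  AlgEquiv.apply_symm_apply _ _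

lemma conjAdjoint_eq_of_forall_repr {x y : End 𝕜 M}
    (h : ∀ j k, z.repr (y (z j)) k = star (z.repr (x (z k)) j)) : conjAdjoint z x = y := by
  refine (LinearMap.toMatrixAlgEquiv z).injective ?_
  rw [toMatrixAlgEquiv_conjAdjoint]
  ext k j
  simp [LinearMap.toMatrixAlgEquiv_apply, h]

lemma conjAdjoint_conjAdjoint (x : End 𝕜 M) : conjAdjoint z (conjAdjoint z x) = x := by
  simp [conjAdjoint]

lemma conjAdjoint_mul (x y : End 𝕜 M) :
    conjAdjoint z (x * y) = conjAdjoint z y * conjAdjoint z x := by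
  simp [conjAdjoint]

lemma conjAdjoint_lie (x y : End 𝕜 M) :
    conjAdjoint z ⁅x, y⁆ = ⁅conjAdjoint z y, conjAdjoint z x⁆ := by
  simp [Ring.lie_def, conjAdjoint_mul]

open scoped ComplexOrder in
lemma trace_mul_conjAdjoint_ne_zero {x : End 𝕜 M} (hx : x ≠ 0) :
    LinearMap.trace 𝕜 M (x * conjAdjoint z x) ≠ 0 := by
  have htrace : LinearMap.trace 𝕜 M (x * conjAdjoint z x) =
      (LinearMap.toMatrixAlgEquiv z (x * conjAdjoint z x)).trace :=
    LinearMap.trace_eq_matrix_trace 𝕜 z _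
  rw [htrace, map_mul, toMatrixAlgEquiv_conjAdjoint, ne_eq,
    Matrix.trace_mul_conjTranspose_self_eq_zero_iff]
  simpa using hx

variable {z} {ι : Type*} [Finite ι] {𝔤 : LieSubalgebra 𝕜 (End 𝕜 M)} {H : LieSubalgebra 𝕜 𝔤}
  {B : LieAlgebra.Basis ι H} (hef : ∀ i, conjAdjoint z (B.e i) = B.f i)

include hef

lemma conjAdjoint_lieBasis_f (i : ι) : conjAdjoint z (B.f i) = B.e i := by
  rw [← hef, conjAdjoint_conjAdjoint]

lemma conjAdjoint_lieBasis_h (i : ι) : conjAdjoint z (B.h i) = B.h i := by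
  rw [← (B.sl2 i).lie_e_f, LieSubalgebra.coe_bracket, conjAdjoint_lie, hef,
    conjAdjoint_lieBasis_f hef]

lemma conjAdjoint_mem (x : 𝔤) : conjAdjoint z x ∈ 𝔤 := by
  have hx : x ∈ LieSubalgebra.lieSpan 𝕜 𝔤 (range B.e ∪ range B.f) :=
    B.span_ef ▸ LieSubalgebra.mem_top x
  induction hx using LieSubalgebra.lieSpan_induction with
  | mem x hx =>
    obtain ⟨i, rfl⟩ | ⟨i, rfl⟩ := hx
    · exact hef i ▸ (B.f i).2
    · exact conjAdjoint_lieBasis_f hef i ▸ (B.e i).2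
  | zero => simp
  | add x y _ _ hx hy =>
    rw [AddMemClass.coe_add, map_add]
    exact add_mem hx hy
  | smul c x _ hx =>
    rw [SetLike.val_smul, map_smulₛₗ]
    exact 𝔤.smul_mem _ hx
  | lie x y _ _ hx hy =>
    rw [LieSubalgebra.coe_bracket, conjAdjoint_lie]
    exact 𝔤.lie_mem hy hx

lemma isAnisotropicAdjoint_conjAdjoint :
    IsAnisotropicAdjoint B (LieModule.traceForm 𝕜 𝔤 M)
      (((conjAdjoint z).domRestrict 𝔤.toSubmodule).codRestrict 𝔤.toSubmodule
        (conjAdjoint_mem hef)) where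
  lieInvariant := LieModule.traceForm_lieInvariant 𝕜 𝔤 M
  map_lie x y := Subtype.ext (conjAdjoint_lie z x y)
  map_h i := Subtype.ext (conjAdjoint_lieBasis_h hef i)
  apply_self_ne_zero hx := trace_mul_conjAdjoint_ne_zero z (by simpa using hx)

end ConjAdjoint

section ZeroExtend

variable {E M R : Type*} [Semiring R] [AddCommMonoid M] [Module R M] {Ψ : Set E}
  (z : Basis Ψ R M) {w : E}

/-- The family `μ ↦ z_μ` extended to all of `E` by `z_μ = 0` for `μ ∉ Ψ`, so that the operators
act by `e_i z_μ = z_{μ + α_i}` and `f_i z_μ = z_{μ - α_i}` without case distinction. -/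
def zeroExtend : E → M :=
  Function.extend Subtype.val z 0

@[simp] lemma zeroExtend_coe (μ : Ψ) : zeroExtend z μ = z μ :=
  Subtype.val_injective.extend_apply z 0 μ

lemma zeroExtend_of_mem (hw : w ∈ Ψ) : zeroExtend z w = z ⟨w, hw⟩ :=
  zeroExtend_coe z ⟨w, hw⟩

lemma zeroExtend_of_notMem (hw : w ∉ Ψ) : zeroExtend z w = 0 :=
  Function.extend_apply' _ _ _ (by simpa using hw)

lemma repr_zeroExtend [DecidableEq E] (w : E) (μ : Ψ) :
    z.repr (zeroExtend z w) μ = if w = μ then 1 else 0 := by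
  by_cases hw : w ∈ Ψ
  · simp [zeroExtend_of_mem z hw, Finsupp.single_apply, Subtype.ext_iff]
  · have hwμ : w ≠ μ := fun h ↦ hw (h ▸ μ.2)
    simp [zeroExtend_of_notMem z hw, hwμ]

end ZeroExtend

section LieAlg

variable {ι E E' M : Type*} [AddCommGroup E] [Module ℚ E] [AddCommGroup E'] [Module ℚ E']
  {P : RootPairing ι ℚ E E'} {b : P.Base} {Ψ : Set E} [AddCommGroup M] [Module ℂ M]

lemma toLinearMap_apply_coroot_injective [P.IsRootSystem] (b : P.Base) :
    Function.Injective fun v (i : b.support) ↦ P.toLinearMap v (P.coroot i) := fun _ _ h ↦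
  P.toPerfPair.injective (b.toCoweightBasis.ext fun i ↦ by simpa using congrFun h i)

lemma nonempty_baseSupport [P.IsRootSystem] [P.IsIrreducible] (b : P.Base) :
    Nonempty b.support := by
  have := RootPairing.IsIrreducible.nontrivial (P := P)
  by_contra! hempty
  exact not_subsingleton E (toLinearMap_apply_coroot_injective b).subsingleton

lemma IsMinusculeUnion.finite [P.IsRootSystem] (hΨ : IsMinusculeUnion b Ψ) : Ψ.Finite :=
  ((Set.Finite.pi' fun _ : b.support ↦ toFinite ({0, 1, -1} : Set ℚ)).preimage
    (toLinearMap_apply_coroot_injective b).injOn).subset fun _ hv i ↦ hΨ.pairing_mem hv i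

lemma IsMinusculeUnion.finiteDimensional [P.IsRootSystem] (hΨ : IsMinusculeUnion b Ψ)
    (z : Basis Ψ ℂ M) : FiniteDimensional ℂ M :=
  have := hΨ.finite.to_subtype
  z.finiteDimensional_of_finite

section RootStrings

variable (hΨ : IsMinusculeUnion b Ψ) {v u : E} {i : ι}

include hΨ

lemma IsMinusculeUnion.abs_pairing_le_one (hv : v ∈ Ψ) : |P.toLinearMap v (P.coroot i)| ≤ 1 := by
  obtain h | h | h := hΨ.pairing_mem hv i
  all_goals simp_all

lemma IsMinusculeUnion.add_root_mem_iff (hv : v ∈ Ψ) :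
    v + P.root i ∈ Ψ ↔ P.toLinearMap v (P.coroot i) = -1 := by
  refine ⟨fun h ↦ ?_, hΨ.add_root_mem hv⟩
  have hle := abs_le.1 (hΨ.abs_pairing_le_one (i := i) h)
  rw [map_add, LinearMap.add_apply, P.root_coroot_two] at hle
  linarith [abs_le.1 (hΨ.abs_pairing_le_one (i := i) hv)]

lemma IsMinusculeUnion.sub_root_mem_iff (hv : v ∈ Ψ) :
    v - P.root i ∈ Ψ ↔ P.toLinearMap v (P.coroot i) = 1 := by
  refine ⟨fun h ↦ ?_, hΨ.sub_root_mem hv⟩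
  have hle := abs_le.1 (hΨ.abs_pairing_le_one (i := i) h)
  rw [map_sub, LinearMap.sub_apply, P.root_coroot_two] at hle
  linarith [abs_le.1 (hΨ.abs_pairing_le_one (i := i) hv)]

lemma IsMinusculeUnion.sub_root_mem_of_two_le (hv : v ∈ Ψ) (hu : u ∈ Ψ)
    (h : 2 ≤ P.toLinearMap (v - u) (P.coroot i)) : v - P.root i ∈ Ψ := by
  rw [map_sub, LinearMap.sub_apply] at h
  refine hΨ.sub_root_mem hv ?_
  linarith [abs_le.1 (hΨ.abs_pairing_le_one (i := i) hv),
    abs_le.1 (hΨ.abs_pairing_le_one (i := i) hu)]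

lemma IsMinusculeUnion.add_root_mem_of_two_le (hv : v ∈ Ψ) (hu : u ∈ Ψ)
    (h : 2 ≤ P.toLinearMap (u - v) (P.coroot i)) : v + P.root i ∈ Ψ := by
  rw [map_sub, LinearMap.sub_apply] at h
  refine hΨ.add_root_mem hv ?_
  linarith [abs_le.1 (hΨ.abs_pairing_le_one (i := i) hv),
    abs_le.1 (hΨ.abs_pairing_le_one (i := i) hu)]

end RootStrings

section Operators

variable (z : Basis Ψ ℂ M) {w : E} {i : b.support}

lemma opH_basis (μ : Ψ) : opH z i (z μ) = (P.toLinearMap μ (P.coroot i) : ℂ) • z μ :=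
  z.constr_basis ..

lemma opH_zeroExtend (w : E) :
    opH z i (zeroExtend z w) = (P.toLinearMap w (P.coroot i) : ℂ) • zeroExtend z w := by
  by_cases hw : w ∈ Ψ
  · simp [zeroExtend_of_mem z hw, opH_basis]
  · simp [zeroExtend_of_notMem z hw]

variable (hΨ : IsMinusculeUnion b Ψ)

lemma opE_zeroExtend (hw : w + P.root i ∈ Ψ → w ∈ Ψ) :
    opE hΨ z i (zeroExtend z w) = zeroExtend z (w + P.root i) := by
  by_cases hwΨ : w ∈ Ψ
  · by_cases h : w + P.root i ∈ Ψ
    · simp [zeroExtend_of_mem z hwΨ, zeroExtend_of_mem z h, opE, (hΨ.add_root_mem_iff hwΨ).1 h]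
    · simp [zeroExtend_of_mem z hwΨ, zeroExtend_of_notMem z h, opE,
        mt (hΨ.add_root_mem_iff hwΨ).2 h]
  · rw [zeroExtend_of_notMem z hwΨ, zeroExtend_of_notMem z (mt hw hwΨ), map_zero]

lemma opF_zeroExtend (hw : w - P.root i ∈ Ψ → w ∈ Ψ) :
    opF hΨ z i (zeroExtend z w) = zeroExtend z (w - P.root i) := by
  by_cases hwΨ : w ∈ Ψ
  · by_cases h : w - P.root i ∈ Ψ
    · simp [zeroExtend_of_mem z hwΨ, zeroExtend_of_mem z h, opF, (hΨ.sub_root_mem_iff hwΨ).1 h]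
    · simp [zeroExtend_of_mem z hwΨ, zeroExtend_of_notMem z h, opF,
        mt (hΨ.sub_root_mem_iff hwΨ).2 h]
  · rw [zeroExtend_of_notMem z hwΨ, zeroExtend_of_notMem z (mt hw hwΨ), map_zero]

lemma opE_basis (μ : Ψ) : opE hΨ z i (z μ) = zeroExtend z (μ + P.root i) := by
  rw [← zeroExtend_coe, opE_zeroExtend z hΨ fun _ ↦ μ.2]

lemma opF_basis (μ : Ψ) : opF hΨ z i (z μ) = zeroExtend z (μ - P.root i) := by
  rw [← zeroExtend_coe, opF_zeroExtend z hΨ fun _ ↦ μ.2]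

end Operators

variable (hΨ : IsMinusculeUnion b Ψ) (z : Basis Ψ ℂ M)

lemma lie_opH_opE (i j : b.support) :
    ⁅opH z j, opE hΨ z i⁆ = (P.pairing i j : ℂ) • opE hΨ z i := by
  refine z.ext fun μ ↦ ?_
  rw [Ring.lie_def, LinearMap.sub_apply, Module.End.mul_apply, Module.End.mul_apply, opH_basis,
    map_smul, LinearMap.smul_apply, opE_basis, opH_zeroExtend, ← sub_smul]
  simp [P.root_coroot_eq_pairing]

lemma lie_opH_opF (i j : b.support) :
    ⁅opH z j, opF hΨ z i⁆ = -(P.pairing i j : ℂ) • opF hΨ z i := by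
  refine z.ext fun μ ↦ ?_
  rw [Ring.lie_def, LinearMap.sub_apply, Module.End.mul_apply, Module.End.mul_apply, opH_basis,
    map_smul, LinearMap.smul_apply, opF_basis, opH_zeroExtend, ← sub_smul]
  simp [P.root_coroot_eq_pairing]

lemma lie_opE_opF_of_ne [Finite ι] [P.IsCrystallographic] {i j : b.support} (hij : i ≠ j) :
    ⁅opE hΨ z i, opF hΨ z j⁆ = 0 := by
  have hle {k l : b.support} (hkl : k ≠ l) : P.toLinearMap (P.root k) (P.coroot l) ≤ 0 := by
    rw [P.root_coroot_eq_pairing, ← intCast_cartanMatrix]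
    exact_mod_cast b.cartanMatrix_le_zero_of_ne k l hkl
  refine z.ext fun μ ↦ ?_
  -- If `μ` and `μ + α_i - α_j` lie in `Ψ`, then so do `μ - α_j` and `μ + α_i`, since
  -- `(α_i, α_j^∨) ≤ 0` and `(α_j, α_i^∨) ≤ 0`.
  have hE : opE hΨ z i (zeroExtend z (μ - P.root j)) = zeroExtend z (μ - P.root j + P.root i) :=
    opE_zeroExtend z hΨ fun h ↦ hΨ.sub_root_mem_of_two_le μ.2 h <| by
      have := hle hij
      simp only [sub_add_eq_sub_sub, sub_sub_cancel, map_sub, LinearMap.sub_apply,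
        P.root_coroot_two]
      linarith
  have hF : opF hΨ z j (zeroExtend z (μ + P.root i)) = zeroExtend z (μ + P.root i - P.root j) :=
    opF_zeroExtend z hΨ fun h ↦ hΨ.add_root_mem_of_two_le μ.2 h <| by
      have := hle hij.symm
      simp only [map_sub, map_add, LinearMap.sub_apply, LinearMap.add_apply, P.root_coroot_two]
      linarith
  rw [Ring.lie_def, LinearMap.sub_apply, Module.End.mul_apply, Module.End.mul_apply, opF_basis,
    opE_basis, hE, hF, sub_add_eq_add_sub, sub_self, LinearMap.zero_apply]

lemma conjAdjoint_opE [Fintype Ψ] [DecidableEq Ψ] (i : b.support) :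
    conjAdjoint z (opE hΨ z i) = opF hΨ z i := by
  classical
  refine conjAdjoint_eq_of_forall_repr z fun μ ν ↦ ?_
  rw [opE_basis, opF_basis, repr_zeroExtend, repr_zeroExtend]
  simp [eq_sub_iff_add_eq, eq_comm, apply_ite star]

instance finiteDimensional_lieAlg [P.IsRootSystem] : FiniteDimensional ℂ (lieAlg hΨ z) :=
  have := hΨ.finiteDimensional z
  inferInstance

/-- `e_i` as an element of `𝔤`. -/
def elE (i : b.support) : lieAlg hΨ z :=
  ⟨opE hΨ z i, LieSubalgebra.subset_lieSpan (.inl ⟨i, rfl⟩)⟩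

/-- `f_i` as an element of `𝔤`. -/
def elF (i : b.support) : lieAlg hΨ z :=
  ⟨opF hΨ z i, LieSubalgebra.subset_lieSpan (.inr ⟨i, rfl⟩)⟩

lemma lieSpan_elE_elF :
    LieSubalgebra.lieSpan ℂ (lieAlg hΨ z) (range (elE hΨ z) ∪ range (elF hΨ z)) = ⊤ := by
  refine top_le_iff.1 (Eq.trans_le (LieSubalgebra.lieSpan_lieSpan_coe_preimage
    (s := range (opE hΨ z) ∪ range (opF hΨ z))).symm (LieSubalgebra.lieSpan_mono ?_))
  rintro ⟨x, hx⟩ (⟨i, hi⟩ | ⟨i, hi⟩)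
  · exact .inl ⟨i, Subtype.ext hi⟩
  · exact .inr ⟨i, Subtype.ext hi⟩

lemma cartan_eq_lieSpan :
    cartan hΨ z = LieSubalgebra.lieSpan ℂ (lieAlg hΨ z) (range (elH hΨ z)) := by
  rw [← LieSubalgebra.toSubmodule_inj, LieSubalgebra.coe_lieSpan_eq_span_of_forall_lie_eq_zero]
  · rfl
  · rintro - ⟨i, rfl⟩ - ⟨j, rfl⟩
    exact lie_elH_elH hΨ z i j

variable [Finite ι] [P.IsRootSystem] [P.IsCrystallographic] [P.IsIrreducible]

/-- The Chevalley–Serre presentation of `𝔤`: the `e_i`, `f_i`, `h_i` are generators satisfying the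
relations prescribed by the Cartan matrix of `Φ`. -/
def lieBasis : LieAlgebra.Basis b.support (cartan hΨ z) where
  A := b.cartanMatrix
  h := elH hΨ z
  e := elE hΨ z
  f := elF hΨ z
  cartan_eq_lieSpan := cartan_eq_lieSpan hΨ z
  span_ef := lieSpan_elE_elF hΨ z
  linInd := linearIndependent_elH hΨ z
  nondegen := b.cartanMatrix_nondegenerate
  sl2 i :=
    { h_ne_zero := (linearIndependent_elH hΨ z).ne_zero i
      lie_e_f := Subtype.ext (lie_opE_opF hΨ z i)
      lie_h_e_nsmul := Subtype.ext <| (lie_opH_opE hΨ z i i).trans <| by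
        simp [elE, ofNat_smul_eq_nsmul]
      lie_h_f_nsmul := Subtype.ext <| (lie_opH_opF hΨ z i i).trans <| by
        simp [elF, ofNat_smul_eq_nsmul] }
  lie_h_h := lie_elH_elH hΨ z
  lie_h_e i j := Subtype.ext <| (lie_opH_opE hΨ z i j).trans <| by
    rw [← intCast_cartanMatrix, Rat.cast_intCast, Int.cast_smul_eq_zsmul]
    rfl
  lie_h_f i j := Subtype.ext <| (lie_opH_opF hΨ z i j).trans <| by
    rw [← intCast_cartanMatrix, Rat.cast_intCast, neg_smul, Int.cast_smul_eq_zsmul, ← neg_smul]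
    rfl
  lie_e_f_ne i j hij := Subtype.ext (lie_opE_opF_of_ne hΨ z hij)

instance isCartanSubalgebra_cartan : (cartan hΨ z).IsCartanSubalgebra :=
  (lieBasis hΨ z).isCartanSubalgebra

instance isSimple_lieAlg [P.IsReduced] : LieAlgebra.IsSimple ℂ (lieAlg hΨ z) := by
  classical
  have := hΨ.finite.fintype
  have := nonempty_baseSupport b
  have hef (i : b.support) : conjAdjoint z ((lieBasis hΨ z).e i) = (lieBasis hΨ z).f i :=
    conjAdjoint_opE hΨ z i
  exact (isAnisotropicAdjoint_conjAdjoint hef).isSimple fun p ↦ b.induction_on_cartanMatrix p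

end LieAlg

section Roots

open LieAlgebra LieAlgebra.IsKilling

variable {ι E E' M : Type*} [AddCommGroup E] [Module ℚ E] [AddCommGroup E'] [Module ℚ E']
  {P : RootPairing ι ℚ E E'} [P.IsRootSystem] [P.IsIrreducible] {b : P.Base} {Ψ : Set E}
  [AddCommGroup M] [Module ℂ M] (hΨ : IsMinusculeUnion b Ψ) (z : Basis Ψ ℂ M)

lemma dot_basisH (v : E) (j : b.support) :
    dot hΨ z v (basisH hΨ z j) = P.toLinearMap v (P.coroot j) :=
  (basisH hΨ z).constr_basis ..

/-- The map `μ ↦ μ̇` as a `ℚ`-linear map. -/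
def dotLinear : E →ₗ[ℚ] Dual ℂ (cartan hΨ z) where
  toFun := dot hΨ z
  map_add' v w := (basisH hΨ z).ext fun j ↦ by simp [dot_basisH]
  map_smul' q v := (basisH hΨ z).ext fun j ↦ by simp [dot_basisH, Rat.smul_def]

lemma dot_injective : Function.Injective (dot hΨ z) := fun v w h ↦
  toLinearMap_apply_coroot_injective b <| funext fun j ↦ by
    simpa [dot_basisH] using LinearMap.congr_fun h (basisH hΨ z j)

variable [Finite ι] [P.IsCrystallographic] [P.IsReduced]

lemma range_dot_root :
    range (fun i ↦ dot hΨ z (P.root i)) = range (rootSystem (cartan hΨ z)).root := by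
  refine range_comp_root_eq_range_rootSystem_root (lieBasis hΨ z) rfl (dotLinear hΨ z)
    fun v j ↦ ?_
  have hj : (lieBasis hΨ z).h' j = basisH hΨ z j := Subtype.ext (coe_basisH hΨ z j).symm
  simp [hj, dotLinear, dot_basisH]

lemma isInternal_rootDecomposition [DecidableEq ι] :
    DirectSum.IsInternal (rootDecomposition hΨ z) := by
  have hinj : Function.Injective fun i ↦ dot hΨ z (P.root i) :=
    (dot_injective hΨ z).comp P.root.injective
  have hdecomp : rootDecomposition hΨ z = fun o ↦ o.elim (cartan hΨ z).toSubmodule fun i ↦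
      (LieModule.weightSpace (lieAlg hΨ z) (dot hΨ z (P.root i))).toSubmodule := by
    funext o
    cases o <;> rfl
  exact hdecomp ▸ isInternal_cartan_weightSpace hinj (range_dot_root hΨ z)

lemma setOf_rootSpace_ne_bot :
    {χ : Dual ℂ (cartan hΨ z) | χ ≠ 0 ∧ rootSpace hΨ z χ ≠ ⊥} =
      range fun i ↦ dot hΨ z (P.root i) := by
  simp only [rootSpace, ne_eq, LieSubmodule.toSubmodule_eq_bot]
  exact setOf_weightSpace_ne_bot.trans (range_dot_root hΨ z).symm

lemma finrank_rootSpace_dot_root (i : ι) :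
    finrank ℂ (rootSpace hΨ z (dot hΨ z (P.root i))) = 1 :=
  finrank_weightSpace_eq_one (range_dot_root hΨ z ▸ mem_range_self i)

end Roots

end Minuscule

end

theorem proposition1p6 {ι E E' M : Type*} [Finite ι] [DecidableEq ι]
    [AddCommGroup E] [Module ℚ E] [AddCommGroup E'] [Module ℚ E']
    (P : RootPairing ι ℚ E E') [P.IsRootSystem] [P.IsCrystallographic] [P.IsReduced]
    [P.IsIrreducible] (b : P.Base)
    (Ψ : Set E) (hΨ : Minuscule.IsMinusculeUnion b Ψ)
    [AddCommGroup M] [Module ℂ M] (z : Module.Basis Ψ ℂ M) :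
    LieAlgebra.IsSimple ℂ (Minuscule.lieAlg hΨ z) ∧
    (Minuscule.cartan hΨ z).IsCartanSubalgebra ∧
    {χ : Module.Dual ℂ (Minuscule.cartan hΨ z) | χ ≠ 0 ∧ Minuscule.rootSpace hΨ z χ ≠ ⊥} =
      Set.range (fun i : ι ↦ Minuscule.dot hΨ z (P.root i)) ∧
    DirectSum.IsInternal (Minuscule.rootDecomposition hΨ z) ∧
    ∀ i : ι, Module.finrank ℂ (Minuscule.rootSpace hΨ z (Minuscule.dot hΨ z (P.root i))) = 1 := by
  exact ⟨Minuscule.isSimple_lieAlg hΨ z, Minuscule.isCartanSubalgebra_cartan hΨ z,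
    Minuscule.setOf_rootSpace_ne_bot hΨ z, Minuscule.isInternal_rootDecomposition hΨ z,
    Minuscule.finrank_rootSpace_dot_root hΨ z⟩
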